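/- Let $E$ be a finite-dimensional complex Hilbert space, and let $L^2(E)$, $L^2(\mathcal L(E))$ be the spaces of square integrable functions on the unit circle $\mathbb T$ (with normalized Lebesgue measure) with values in $E$ and in $\mathcal L(E)$. Let $H^2(E)$, $H^2(\mathcal L(E))$ be the subspaces of functions whose Fourier coefficients of negative index vanish; the elements of these are identified with analytic functions in the unit disc $\mathbb D$. Let $\Theta$ be a pure inner function, that is, $\Theta\in H^2(\mathcal L(E))$, the boundary values $\Theta(\zeta)$ are unitary for almost every $\zeta\in\mathbb T$, and $\|\Theta(0)\|<1$. Let $\mathcal K_\Theta=H^2(E)\ominus\Theta H^2(E)$ be the model space, with orthogonal projection $P_\Theta:L^2(E)\to\mathcal K_\Theta$. Let $\mathcal{MT}(\mathcal K_\Theta)$ be the set of matrix-valued truncated Toeplitz operators, that is, of bounded operators $A$ on $\mathcal K_\Theta$ for which there is $\Phi\in L^2(\mathcal L(E))$ with $Af=P_\Theta(\Phi f)$ for every bounded function $f\in\mathcal K_\Theta$. For $\lambda\in\mathbb D$ let $K_\lambda,\widetilde K_\lambda:E\to\mathcal K_\Theta$ be the bounded operators $$(K_\lambda x)(z)=\frac{1}{1-\overline\lambda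 z}\bigl(I-\Theta(z)\Theta(\lambda)^*\bigr)x,\qquad (\widetilde K_\lambda x)(z)=\frac{1}{z-\lambda}\bigl(\Theta(z)-\Theta(\lambda)\bigr)x .$$ **Theorem.** For every $Y\in\mathcal L(E)$ and every $\lambda\in\mathbb D$, the operators $K_\lambda Y\widetilde K_\lambda^*$ and $\widetilde K_\lambda YK_\lambda^*$ on $\mathcal K_\Theta$ belong to $\mathcal{MT}(\mathcal K_\Theta)$, and both have rank equal to the rank of $Y$. -/

import Mathlib

noncomputable section

namespace ModelSpace

open MeasureTheory AddCircle Complex Filter Topology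
open scoped ENNReal InnerProductSpace

set_option linter.unusedSectionVars false


instance fact_two_pi_pos : Fact (0 < 2 * Real.pi) := ⟨Real.two_pi_pos⟩

/-- The unit circle, parametrized by the angle `t` modulo `2 * π`. -/
abbrev Torus : Type := AddCircle (2 * Real.pi)

/-- Normalized Lebesgue measure `dt / (2 * π)` on the circle. -/
abbrev mu : Measure Torus := haarAddCircle

/-- The coordinate function `e ^ (i * t)` on the circle. -/
abbrev zeta (t : Torus) : ℂ := fourier 1 t

/-- The space `L²(F)` of square integrable functions on the circle with values in `F`. -/
abbrev L2 (F : Type*) [NormedAddCommGroup F] : Type _ := Lp F 2 mu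

section General

variable {F : Type*} [NormedAddCommGroup F] [NormedSpace ℂ F]

theorem zeta_norm (t : Torus) : ‖zeta t‖ = 1 := by
  unfold zeta
  rw [fourier_apply, Circle.norm_coe]

theorem zeta_ne_zero (t : Torus) : zeta t ≠ 0 := by
  rw [← norm_ne_zero_iff, zeta_norm]; exact one_ne_zero

theorem one_sub_ne_zero {c : ℂ} (hc : ‖c‖ < 1) (t : Torus) : 1 - c * zeta t ≠ 0 := by
  intro h
  have h1 : ‖c * zeta t‖ = 1 := by rw [← sub_eq_zero.mp h, norm_one]
  rw [norm_mul, zeta_norm, mul_one] at h1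
  exact hc.ne h1

theorem sub_ne_zero' {c : ℂ} (hc : ‖c‖ < 1) (t : Torus) : zeta t - c ≠ 0 := by
  intro h
  have h1 : ‖c‖ = 1 := by rw [← sub_eq_zero.mp h, zeta_norm]
  exact hc.ne h1

theorem continuous_zeta : Continuous zeta := map_continuous (fourier 1)

theorem integrable_L2 (f : L2 F) : Integrable (f : Torus → F) mu :=
  (Lp.memLp f).integrable one_le_two

theorem norm_fourierCoeff_le (f : Torus → F) (n : ℤ) :
    ‖fourierCoeff f n‖ ≤ ∫ t, ‖f t‖ ∂mu := by
  refine (norm_integral_le_integral_norm _).trans (le_of_eq ?_)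
  refine integral_congr_ae (ae_of_all _ fun t => ?_)
  simp only [norm_smul]
  rw [fourier_apply, Circle.norm_coe, one_mul]

theorem norm_fourierCoeff_le_norm (f : L2 F) (n : ℤ) : ‖fourierCoeff f n‖ ≤ ‖f‖ := by
  refine (norm_fourierCoeff_le _ n).trans ?_
  rw [integral_norm_eq_lintegral_enorm (Lp.memLp f).1, ← eLpNorm_one_eq_lintegral_enorm,
    Lp.norm_def]
  exact ENNReal.toReal_mono (Lp.eLpNorm_ne_top f)
    (eLpNorm_le_eLpNorm_of_exponent_le one_le_two (Lp.memLp f).1)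

theorem fourierCoeff_add_coe (f g : L2 F) (n : ℤ) :
    fourierCoeff (f + g : L2 F) n = fourierCoeff f n + fourierCoeff g n := by
  rw [fourierCoeff_congr_ae (Lp.coeFn_add f g),
    fourierCoeff.add (integrable_L2 f) (integrable_L2 g)]
  rfl

theorem fourierCoeff_smul_coe (c : ℂ) (f : L2 F) (n : ℤ) :
    fourierCoeff (c • f : L2 F) n = c • fourierCoeff f n := by
  rw [fourierCoeff_congr_ae (Lp.coeFn_smul c f), fourierCoeff.const_smul]

/-- The Fourier coefficient of index `n`, as a bounded linear map on `L²(F)`. -/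
def coeffL (F : Type*) [NormedAddCommGroup F] [NormedSpace ℂ F] (n : ℤ) : L2 F →L[ℂ] F :=
  LinearMap.mkContinuous
    { toFun := fun f => fourierCoeff f n
      map_add' := fun f g => fourierCoeff_add_coe f g n
      map_smul' := fun c f => fourierCoeff_smul_coe c f n } 1
    (fun f => by simpa using norm_fourierCoeff_le_norm f n)

theorem coeffL_apply (n : ℤ) (f : L2 F) : coeffL F n f = fourierCoeff f n := rfl

/-- The Hardy space `H²(F)`: the functions in `L²(F)` whose Fourier coefficients of negative index
vanish. -/
def Hardy (F : Type*) [NormedAddCommGroup F] [NormedSpace ℂ F] [CompleteSpace F] :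
    Submodule ℂ (L2 F) where
  carrier := {f | ∀ n : ℤ, n < 0 → fourierCoeff f n = 0}
  add_mem' := fun {f g} hf hg n hn => by rw [fourierCoeff_add_coe, hf n hn, hg n hn, add_zero]
  zero_mem' := fun n _ => (coeffL F n).map_zero
  smul_mem' := fun c f hf n hn => by rw [fourierCoeff_smul_coe, hf n hn, smul_zero]

theorem isClosed_Hardy [CompleteSpace F] : IsClosed (Hardy F : Set (L2 F)) := by
  have h : (Hardy F : Set (L2 F)) = ⋂ n : ℤ, ⋂ _ : n < 0, {f | coeffL F n f = 0} := by
    ext f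
    simp only [Set.mem_iInter, Set.mem_ofPred_eq]
    rfl
  rw [h]
  exact isClosed_iInter fun n => isClosed_iInter fun _ =>
    isClosed_eq (coeffL F n).continuous continuous_const

/-- The value at a point `l` of the unit disc of the analytic function with boundary values `f`,
that is, the sum of the power series whose coefficients are the Fourier coefficients of `f` of
nonnegative index. -/
def diskValue (f : Torus → F) (l : ℂ) : F := ∑' n : ℕ, l ^ n • fourierCoeff f n

theorem summable_diskValue [CompleteSpace F] (f : Torus → F) {l : ℂ} (hl : ‖l‖ < 1) :
    Summable fun n : ℕ => l ^ n • fourierCoeff f n := by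
  refine Summable.of_norm_bounded
    ((summable_geometric_of_lt_one (norm_nonneg l) hl).mul_right (∫ t, ‖f t‖ ∂mu)) fun n => ?_
  rw [norm_smul, norm_pow]
  exact mul_le_mul_of_nonneg_left (norm_fourierCoeff_le f n) (by positivity)

theorem fourierCoeff_zeta_smul (f : Torus → F) (n : ℤ) :
    fourierCoeff (fun t => zeta t • f t) n = fourierCoeff f (n - 1) := by
  unfold fourierCoeff
  refine integral_congr_ae (ae_of_all _ fun t => ?_)
  simp only [smul_smul, zeta]
  rw [← fourier_add, show -n + 1 = -(n - 1) by ring]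

theorem integrable_zeta_smul {f : Torus → F} (hf : Integrable f mu) :
    Integrable (fun t => zeta t • f t) mu := hf.fourier_smul 1

theorem fourierCoeff_sub' {f g : Torus → F} (hf : Integrable f mu) (hg : Integrable g mu) (n : ℤ) :
    fourierCoeff (fun t => f t - g t) n = fourierCoeff f n - fourierCoeff g n := by
  have := congrFun (fourierCoeff.add hf hg.neg) n
  have h2 := fourierCoeff.const_smul g (-1) n
  rw [neg_one_smul, neg_one_smul] at h2
  rw [Pi.add_apply, h2, ← sub_eq_add_neg, ← sub_eq_add_neg] at this
  exact this

theorem fourierCoeff_one_sub_smul {f : Torus → F} (hf : Integrable f mu) (c : ℂ) (n : ℤ) :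
    fourierCoeff (fun t => (1 - c * zeta t) • f t) n
      = fourierCoeff f n - c • fourierCoeff f (n - 1) := by
  have h : (fun t => (1 - c * zeta t) • f t) = fun t => f t - c • (zeta t • f t) := by
    funext t; rw [sub_smul, one_smul, mul_smul]
  rw [h, fourierCoeff_sub' (g := fun t => c • (zeta t • f t)) hf ((integrable_zeta_smul hf).smul c),
    ← fourierCoeff_zeta_smul]
  congr 1
  exact fourierCoeff.const_smul (fun t => zeta t • f t) c n

theorem fourierCoeff_sub_smul {f : Torus → F} (hf : Integrable f mu) (c : ℂ) (n : ℤ) :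
    fourierCoeff (fun t => (zeta t - c) • f t) n
      = fourierCoeff f (n - 1) - c • fourierCoeff f n := by
  have h : (fun t => (zeta t - c) • f t) = fun t => zeta t • f t - c • f t := by
    funext t; rw [sub_smul]
  rw [h, fourierCoeff_sub' (g := fun t => c • f t) (integrable_zeta_smul hf) (hf.smul c),
    ← fourierCoeff_zeta_smul]
  congr 1
  exact fourierCoeff.const_smul f c n

/-- Division by `1 - c * z` preserves the vanishing of the negative Fourier coefficients. -/
theorem analytic_of_one_sub_smul {f : Torus → F} (hf : Integrable f mu) {c : ℂ} (hc : ‖c‖ < 1)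
    (h : ∀ n : ℤ, n < 0 → fourierCoeff (fun t => (1 - c * zeta t) • f t) n = 0) :
    ∀ n : ℤ, n < 0 → fourierCoeff f n = 0 := by
  intro n hn
  have key : ∀ k : ℕ, fourierCoeff f n = c ^ k • fourierCoeff f (n - k) := by
    intro k
    induction k with
    | zero => simp
    | succ k ih =>
      have h1 := h (n - k) (by omega)
      rw [fourierCoeff_one_sub_smul hf, sub_eq_zero] at h1
      rw [ih, h1, smul_smul, ← pow_succ]
      congr 2
      push_cast; ring
  have hlim : Tendsto (fun k : ℕ => ‖c‖ ^ k * ∫ t, ‖f t‖ ∂mu) atTop (𝓝 0) := by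
    simpa using (tendsto_pow_atTop_nhds_zero_of_lt_one (norm_nonneg c) hc).mul_const _
  have hle : ‖fourierCoeff f n‖ ≤ 0 := by
    refine ge_of_tendsto' hlim fun k => ?_
    rw [key k, norm_smul, norm_pow]
    exact mul_le_mul_of_nonneg_left (norm_fourierCoeff_le f _) (by positivity)
  simpa using hle

/-- The sum of the first terms of the power series of `(z - c) * f`. -/
theorem sum_sub_smul {f : Torus → F} (hf : Integrable f mu) (c : ℂ) (N : ℕ) :
    ∑ n ∈ Finset.range N, c ^ n • fourierCoeff (fun t => (zeta t - c) • f t) n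
      = fourierCoeff f (-1) - c ^ N • fourierCoeff f ((N : ℤ) - 1) := by
  induction N with
  | zero => simp
  | succ N ih =>
    rw [Finset.sum_range_succ, ih, fourierCoeff_sub_smul hf, smul_sub, smul_smul, ← pow_succ]
    rw [show (((N + 1 : ℕ) : ℤ) - 1) = N by push_cast; ring]
    abel

theorem diskValue_sub_smul [CompleteSpace F] {f : Torus → F} (hf : Integrable f mu) {c : ℂ}
    (hc : ‖c‖ < 1) :
    diskValue (fun t => (zeta t - c) • f t) c = fourierCoeff f (-1) := by
  refine tendsto_nhds_unique (summable_diskValue _ hc).hasSum.tendsto_sum_nat ?_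
  simp_rw [sum_sub_smul hf]
  have hlim : Tendsto (fun k : ℕ => c ^ k • fourierCoeff f ((k : ℤ) - 1)) atTop (𝓝 0) := by
    have h0 : Tendsto (fun k : ℕ => ‖c‖ ^ k * ∫ t, ‖f t‖ ∂mu) atTop (𝓝 0) := by
      simpa using (tendsto_pow_atTop_nhds_zero_of_lt_one (norm_nonneg c) hc).mul_const _
    refine squeeze_zero_norm (fun k => ?_) h0
    rw [norm_smul, norm_pow]
    exact mul_le_mul_of_nonneg_left (norm_fourierCoeff_le f _) (by positivity)
  simpa using tendsto_const_nhds.sub hlim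

/-- Division by `z - c` of a function that vanishes at `c` preserves the vanishing of the negative
Fourier coefficients. -/
theorem analytic_of_sub_smul [CompleteSpace F] {f : Torus → F} (hf : Integrable f mu) {c : ℂ}
    (hc : ‖c‖ < 1)
    (h : ∀ n : ℤ, n < 0 → fourierCoeff (fun t => (zeta t - c) • f t) n = 0)
    (h0 : diskValue (fun t => (zeta t - c) • f t) c = 0) :
    ∀ n : ℤ, n < 0 → fourierCoeff f n = 0 := by
  have key : ∀ k : ℕ, fourierCoeff f (-1 - k) = 0 := by
    intro k
    induction k with
    | zero => rw [diskValue_sub_smul hf hc] at h0; simpa using h0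
    | succ k ih =>
      have h1 := h (-1 - k) (by omega)
      rw [fourierCoeff_sub_smul hf, ih, smul_zero, sub_zero] at h1
      rw [← h1]; congr 1; push_cast; ring
  intro n hn
  have := key (-1 - n).toNat
  rwa [Int.toNat_of_nonneg (by omega), sub_sub_cancel] at this

theorem fourierCoeff_clm {G : Type*} [NormedAddCommGroup G] [NormedSpace ℂ G] [CompleteSpace F]
    [CompleteSpace G] (L : F →L[ℂ] G) {f : Torus → F} (hf : Integrable f mu) (n : ℤ) :
    fourierCoeff (fun t => L (f t)) n = L (fourierCoeff f n) := by
  unfold fourierCoeff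
  rw [← L.integral_comp_comm (hf.fourier_smul (-n))]
  simp only [map_smul]

theorem diskValue_clm {G : Type*} [NormedAddCommGroup G] [NormedSpace ℂ G] [CompleteSpace F]
    [CompleteSpace G] (L : F →L[ℂ] G) {f : Torus → F} (hf : Integrable f mu) {l : ℂ}
    (hl : ‖l‖ < 1) : diskValue (fun t => L (f t)) l = L (diskValue f l) := by
  unfold diskValue
  rw [L.map_tsum (summable_diskValue f hl)]
  simp only [fourierCoeff_clm L hf, map_smul]

theorem diskValue_sub [CompleteSpace F] {f g : Torus → F} (hf : Integrable f mu)
    (hg : Integrable g mu) {l : ℂ} (hl : ‖l‖ < 1) :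
    diskValue (fun t => f t - g t) l = diskValue f l - diskValue g l := by
  unfold diskValue
  rw [← (summable_diskValue f hl).tsum_sub (summable_diskValue g hl)]
  simp only [fourierCoeff_sub' hf hg, smul_sub]

theorem fourierCoeff_const [CompleteSpace F] (a : F) (n : ℤ) :
    fourierCoeff (fun _ : Torus => a) n = if n = 0 then a else 0 := by
  have h := fourierCoeff_clm (ContinuousLinearMap.toSpanSingleton ℂ a)
    ((map_continuous (fourier (T := 2 * Real.pi) 0)).integrable_of_hasCompactSupport
      (HasCompactSupport.of_compactSpace _) : Integrable _ mu) n
  rw [fourierCoeff_fourier] at h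
  simp only [fourier_zero, ContinuousLinearMap.toSpanSingleton_apply, one_smul] at h
  rw [h]
  by_cases hn : n = 0
  · simp [hn]
  · simp [hn]

theorem diskValue_const [CompleteSpace F] (a : F) (l : ℂ) :
    diskValue (fun _ : Torus => a) l = a := by
  unfold diskValue
  rw [tsum_eq_single 0]
  · simp [fourierCoeff_const]
  · intro n hn
    simp [fourierCoeff_const, hn]

theorem memLp_smul_of_continuous {s : Torus → ℂ} (hs : Continuous s) {f : Torus → F}
    (hf : MemLp f 2 mu) : MemLp (fun t => s t • f t) 2 mu := by
  obtain ⟨C, hC⟩ := isCompact_univ.exists_bound_of_continuousOn hs.continuousOn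
  refine hf.of_le_mul (c := C) (hs.aestronglyMeasurable.smul hf.1) (ae_of_all _ fun t => ?_)
  rw [norm_smul]
  exact mul_le_mul_of_nonneg_right (hC t (Set.mem_univ t)) (norm_nonneg _)

theorem continuous_one_sub_inv {c : ℂ} (hc : ‖c‖ < 1) : Continuous fun t => (1 - c * zeta t)⁻¹ :=
  (continuous_const.sub (continuous_const.mul continuous_zeta)).inv₀ (one_sub_ne_zero hc)

theorem continuous_sub_inv {c : ℂ} (hc : ‖c‖ < 1) : Continuous fun t => (zeta t - c)⁻¹ :=
  (continuous_zeta.sub continuous_const).inv₀ (sub_ne_zero' hc)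

theorem integrable_of_memLp {f : Torus → F} (hf : MemLp f 2 mu) : Integrable f mu :=
  hf.integrable one_le_two

end General

section Model

variable {E : Type*} [NormedAddCommGroup E] [InnerProductSpace ℂ E] [CompleteSpace E]

/-- An inner function: an element of `H²(L(E))` whose boundary values are almost everywhere unitary.
The Hilbert-Schmidt norm and the operator norm of `L(E)` are equivalent, as `E` is finite
dimensional, so that they give the same space `L²(L(E))`. -/
structure IsInner (Θ : L2 (E →L[ℂ] E)) : Prop where
  mem_hardy : Θ ∈ Hardy (E →L[ℂ] E)
  unitary_ae : ∀ᵐ t ∂mu, Θ t ∈ unitary (E →L[ℂ] E)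

/-- The inner function is pure: `‖Θ(0)‖ < 1`. -/
def IsPure (Θ : L2 (E →L[ℂ] E)) : Prop := ‖diskValue Θ 0‖ < 1

/-- The subspace `Θ H²(E)` of `L²(E)`. -/
def mulHardy (Θ : L2 (E →L[ℂ] E)) : Submodule ℂ (L2 E) where
  carrier := {g | ∃ h ∈ Hardy E, ∀ᵐ t ∂mu, g t = Θ t (h t)}
  add_mem' := by
    rintro f g ⟨h, hh, hf⟩ ⟨k, hk, hg⟩
    refine ⟨h + k, add_mem hh hk, ?_⟩
    filter_upwards [hf, hg, Lp.coeFn_add f g, Lp.coeFn_add h k] with t h1 h2 h3 h4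
    rw [h3, h4, Pi.add_apply, Pi.add_apply, map_add, h1, h2]
  zero_mem' := by
    refine ⟨0, zero_mem _, ?_⟩
    filter_upwards [Lp.coeFn_zero E 2 mu] with t h1
    rw [h1, Pi.zero_apply, map_zero]
  smul_mem' := by
    rintro c f ⟨h, hh, hf⟩
    refine ⟨c • h, Submodule.smul_mem _ c hh, ?_⟩
    filter_upwards [hf, Lp.coeFn_smul c f, Lp.coeFn_smul c h] with t h1 h2 h3
    rw [h2, h3, Pi.smul_apply, Pi.smul_apply, map_smul, h1]

/-- The model space `K_Θ = H²(E) ⊖ Θ H²(E)`. -/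
def modelSpace (Θ : L2 (E →L[ℂ] E)) : Submodule ℂ (L2 E) := Hardy E ⊓ (mulHardy Θ)ᗮ

instance completeSpace_modelSpace (Θ : L2 (E →L[ℂ] E)) : CompleteSpace (modelSpace Θ) := by
  have h : IsClosed (modelSpace Θ : Set (L2 E)) :=
    isClosed_Hardy.inter (Submodule.isClosed_orthogonal _)
  exact h.completeSpace_coe

theorem aestronglyMeasurable_apply {A : Torus → E →L[ℂ] E} {f : Torus → E}
    (hA : AEStronglyMeasurable A mu) (hf : AEStronglyMeasurable f mu) :
    AEStronglyMeasurable (fun t => A t (f t)) mu :=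
  (isBoundedBilinearMap_apply.continuous (𝕜 := ℂ)).comp_aestronglyMeasurable (hA.prodMk hf)

theorem memLp_apply (Φ : L2 (E →L[ℂ] E)) {f : Torus → E} (hf : MemLp f ∞ mu) :
    MemLp (fun t => Φ t (f t)) 2 mu :=
  MemLp.of_bilin (p := 2) (q := ∞) (r := 2) (fun (A : E →L[ℂ] E) (x : E) => A x) 1 (Lp.memLp Φ) hf
    (aestronglyMeasurable_apply (Lp.memLp Φ).1 hf.1)
    (ae_of_all _ fun t => by simpa using (Φ t).le_opNNNorm (f t))

/-- The product `Φ f` in `L²(E)` of `Φ` in `L²(L(E))` and a bounded function `f`. -/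
def mulBounded (Φ : L2 (E →L[ℂ] E)) (f : L2 E) (hf : MemLp f ∞ mu) : L2 E :=
  (memLp_apply Φ hf).toLp (fun t => Φ t (f t))

/-- The set `MT(K_Θ)` of matrix-valued truncated Toeplitz operators on `K_Θ`: the bounded operators
`A` for which there is a symbol `Φ` in `L²(L(E))` such that `A f = P_Θ (Φ f)` for all bounded
functions `f` in `K_Θ`. -/
def MT (Θ : L2 (E →L[ℂ] E)) : Set (modelSpace Θ →L[ℂ] modelSpace Θ) :=
  {A | ∃ Φ : L2 (E →L[ℂ] E), ∀ (f : modelSpace Θ) (hf : MemLp ((f : L2 E) : Torus → E) ∞ mu),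
    A f = (modelSpace Θ).orthogonalProjectionOnto (mulBounded Φ f hf)}

/-- The function `z ↦ (1 - conj l * z)⁻¹ (I - Θ(z) Θ(l)*) x` on the circle. -/
def kernelFun (Θ : L2 (E →L[ℂ] E)) (l : ℂ) (x : E) (t : Torus) : E :=
  (1 - (starRingEnd ℂ) l * zeta t)⁻¹ • (x - Θ t (ContinuousLinearMap.adjoint (diskValue Θ l) x))

/-- The function `z ↦ (z - l)⁻¹ (Θ(z) - Θ(l)) x` on the circle. -/
def dualKernelFun (Θ : L2 (E →L[ℂ] E)) (l : ℂ) (x : E) (t : Torus) : E :=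
  (zeta t - l)⁻¹ • (Θ t x - diskValue Θ l x)

theorem memLp_apply_const (Θ : L2 (E →L[ℂ] E)) (x : E) : MemLp (fun t => Θ t x) 2 mu :=
  memLp_apply Θ (memLp_const x)

theorem memLp_kernelFun (Θ : L2 (E →L[ℂ] E)) {l : ℂ} (hl : ‖l‖ < 1) (x : E) :
    MemLp (kernelFun Θ l x) 2 mu :=
  memLp_smul_of_continuous (continuous_one_sub_inv (by rwa [RCLike.norm_conj]))
    ((memLp_const x).sub (memLp_apply_const Θ _))

theorem memLp_dualKernelFun (Θ : L2 (E →L[ℂ] E)) {l : ℂ} (hl : ‖l‖ < 1) (x : E) :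
    MemLp (dualKernelFun Θ l x) 2 mu :=
  memLp_smul_of_continuous (continuous_sub_inv hl) ((memLp_apply_const Θ x).sub (memLp_const _))

theorem IsInner.inner_apply {Θ : L2 (E →L[ℂ] E)} (hΘ : IsInner Θ) :
    ∀ᵐ t ∂mu, ∀ x y : E, ⟪Θ t x, Θ t y⟫_ℂ = ⟪x, y⟫_ℂ := by
  filter_upwards [hΘ.unitary_ae] with t ht x y
  rw [← ContinuousLinearMap.adjoint_inner_right, ← ContinuousLinearMap.comp_apply]
  have := (Unitary.mem_iff.mp ht).1
  rw [ContinuousLinearMap.star_eq_adjoint, ContinuousLinearMap.mul_def] at this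
  rw [this, one_apply_eq_self]

theorem IsInner.memLp_mul {Θ : L2 (E →L[ℂ] E)} (hΘ : IsInner Θ) {g : Torus → E}
    (hg : MemLp g 2 mu) : MemLp (fun t => Θ t (g t)) 2 mu := by
  refine hg.of_le_mul (c := 1) (aestronglyMeasurable_apply (Lp.memLp Θ).1 hg.1) ?_
  filter_upwards [hΘ.inner_apply] with t ht
  rw [one_mul, @norm_eq_sqrt_re_inner ℂ, @norm_eq_sqrt_re_inner ℂ _ _ _ _ (g t), ht]

theorem fourierCoeff_apply (Θ : L2 (E →L[ℂ] E)) (x : E) (n : ℤ) :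
    fourierCoeff (fun t => Θ t x) n = fourierCoeff Θ n x :=
  fourierCoeff_clm (ContinuousLinearMap.apply ℂ E x) (integrable_L2 Θ) n

theorem diskValue_apply (Θ : L2 (E →L[ℂ] E)) (x : E) {l : ℂ} (hl : ‖l‖ < 1) :
    diskValue (fun t => Θ t x) l = diskValue Θ l x :=
  diskValue_clm (ContinuousLinearMap.apply ℂ E x) (integrable_L2 Θ) hl

variable [FiniteDimensional ℂ E]

/-- A function without negative Fourier coefficients is orthogonal to a function without nonnegative
ones. -/
theorem inner_eq_zero_of_fourierCoeff {v g : L2 E} (hg : ∀ n : ℤ, n < 0 → fourierCoeff g n = 0)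
    (hv : ∀ n : ℤ, 0 ≤ n → fourierCoeff v n = 0) : ⟪v, g⟫_ℂ = 0 := by
  set b := stdOrthonormalBasis ℂ E
  have h1 : ∀ i, ⟪(innerSL ℂ (b i)).compLp v, (innerSL ℂ (b i)).compLp g⟫_ℂ = 0 := by
    intro i
    rw [← fourierBasis.tsum_inner_mul_inner]
    have hz : ∀ n : ℤ, ⟪(innerSL ℂ (b i)).compLp v, fourierBasis (T := 2 * Real.pi) n⟫_ℂ *
        ⟪fourierBasis (T := 2 * Real.pi) n, (innerSL ℂ (b i)).compLp g⟫_ℂ = 0 := by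
      have hc : ∀ (w : L2 E) (n : ℤ), ⟪fourierBasis (T := 2 * Real.pi) n,
          (innerSL ℂ (b i)).compLp w⟫_ℂ = ⟪b i, fourierCoeff w n⟫_ℂ := by
        intro w n
        rw [← HilbertBasis.repr_apply_apply, fourierBasis_repr,
          fourierCoeff_congr_ae (ContinuousLinearMap.coeFn_compLp _ w)]
        exact fourierCoeff_clm (innerSL ℂ (b i)) (integrable_L2 w) n
      intro n
      rcases lt_or_ge n 0 with hn | hn
      · rw [hc, hg n hn, inner_zero_right, mul_zero]
      · rw [← inner_conj_symm, hc, hv n hn, inner_zero_right, map_zero, zero_mul]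
    simp only [hz, tsum_zero]
  have h2 : ⟪v, g⟫_ℂ = ∑ i, ⟪(innerSL ℂ (b i)).compLp v, (innerSL ℂ (b i)).compLp g⟫_ℂ := by
    simp only [L2.inner_def]
    rw [← integral_finsetSum _ fun i _ => L2.integrable_inner _ _]
    refine integral_congr_ae ?_
    have hall : ∀ᵐ t ∂mu, ∀ i, (innerSL ℂ (b i)).compLp v t = ⟪b i, v t⟫_ℂ ∧
        (innerSL ℂ (b i)).compLp g t = ⟪b i, g t⟫_ℂ := by
      rw [ae_all_iff]
      intro i
      filter_upwards [ContinuousLinearMap.coeFn_compLp (innerSL ℂ (b i)) v,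
        ContinuousLinearMap.coeFn_compLp (innerSL ℂ (b i)) g] with t h1 h2
      exact ⟨h1, h2⟩
    filter_upwards [hall] with t ht
    rw [← b.sum_inner_mul_inner (v t) (g t)]
    refine Finset.sum_congr rfl fun i _ => ?_
    rw [(ht i).1, (ht i).2, RCLike.inner_apply, inner_conj_symm, mul_comm]
  rw [h2]
  exact Finset.sum_eq_zero fun i _ => h1 i

theorem IsInner.analytic_mul {Θ : L2 (E →L[ℂ] E)} (hΘ : IsInner Θ) {g : Torus → E}
    (hgm : MemLp g 2 mu) (hg : ∀ n : ℤ, n < 0 → fourierCoeff g n = 0) :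
    ∀ n : ℤ, n < 0 → fourierCoeff (fun t => Θ t (g t)) n = 0 := by
  intro n hn
  refine ext_inner_left ℂ fun x => ?_
  rw [inner_zero_right]
  have hadj : MemLp (fun t => ContinuousLinearMap.adjoint (Θ t) x) 2 mu := by
    refine (Lp.memLp Θ).of_le_mul (c := ‖x‖) ?_ (ae_of_all _ fun t => ?_)
    · exact aestronglyMeasurable_apply
        (ContinuousLinearMap.adjoint.continuous.comp_aestronglyMeasurable (Lp.memLp Θ).1)
        aestronglyMeasurable_const
    · have h1 := (ContinuousLinearMap.adjoint (Θ t)).le_opNorm x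
      rw [LinearIsometryEquiv.norm_map] at h1
      exact h1.trans_eq (mul_comm _ _)
  have hvm : MemLp (fun t => fourier n t • ContinuousLinearMap.adjoint (Θ t) x) 2 mu :=
    memLp_smul_of_continuous (map_continuous (fourier n)) hadj
  have key : ⟪hvm.toLp _, hgm.toLp g⟫_ℂ = 0 := by
    refine inner_eq_zero_of_fourierCoeff (fun k hk => ?_) (fun m hm => ?_)
    · rw [fourierCoeff_congr_ae hgm.coeFn_toLp, hg k hk]
    · rw [fourierCoeff_congr_ae hvm.coeFn_toLp]
      refine ext_inner_left ℂ fun y => ?_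
      rw [inner_zero_right, fourierCoeff,
        ← integral_inner ((integrable_of_memLp hvm).fourier_smul (-m)) y]
      have h1 : ∀ t, ⟪y, fourier (-m) t • fourier n t • ContinuousLinearMap.adjoint (Θ t) x⟫_ℂ
          = (starRingEnd ℂ) ⟪x, fourier (-(n - m)) t • Θ t y⟫_ℂ := by
        intro t
        rw [smul_smul, ← fourier_add, inner_smul_right, ContinuousLinearMap.adjoint_inner_right,
          inner_smul_right, map_mul, inner_conj_symm, ← fourier_neg]
        congr 3
        ring
      simp only [h1]
      rw [integral_conj, integral_inner
        ((integrable_of_memLp (memLp_apply_const Θ y)).fourier_smul _) x]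
      have h2 : ∫ t, fourier (-(n - m)) t • Θ t y ∂mu = 0 := by
        have := fourierCoeff_apply Θ y (n - m)
        rw [hΘ.mem_hardy (n - m) (by omega)] at this
        exact this
      rw [h2, inner_zero_right, map_zero]
  rw [L2.inner_def] at key
  rw [fourierCoeff, ← integral_inner
    ((integrable_of_memLp (hΘ.memLp_mul hgm)).fourier_smul (-n)) x, ← key]
  refine integral_congr_ae ?_
  filter_upwards [hvm.coeFn_toLp, hgm.coeFn_toLp] with t h1 h2
  rw [h1, h2, inner_smul_left, ContinuousLinearMap.adjoint_inner_left, inner_smul_right,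
    fourier_neg]

theorem IsInner.diskValue_mul {Θ : L2 (E →L[ℂ] E)} (hΘ : IsInner Θ) {g : Torus → E}
    (hgm : MemLp g 2 mu) (hg : ∀ n : ℤ, n < 0 → fourierCoeff g n = 0) {l : ℂ} (hl : ‖l‖ < 1) :
    diskValue (fun t => Θ t (g t)) l = diskValue Θ l (diskValue g l) := by
  set a := diskValue g l with ha
  set g1 : Torus → E := fun t => (zeta t - l)⁻¹ • (g t - a) with hg1
  have hg1m : MemLp g1 2 mu :=
    memLp_smul_of_continuous (continuous_sub_inv hl) (hgm.sub (memLp_const a))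
  have hmul : (fun t => (zeta t - l) • g1 t) = fun t => g t - a := by
    funext t
    rw [hg1]
    exact smul_inv_smul₀ (sub_ne_zero' hl t) _
  have hg1a : ∀ n : ℤ, n < 0 → fourierCoeff g1 n = 0 := by
    refine analytic_of_sub_smul (integrable_of_memLp hg1m) hl (fun n hn => ?_) ?_
    · rw [hmul, fourierCoeff_sub' (integrable_of_memLp hgm) (integrable_const a), hg n hn,
        fourierCoeff_const, if_neg hn.ne, sub_zero]
    · rw [hmul, diskValue_sub (integrable_of_memLp hgm) (integrable_const a) hl, diskValue_const,
        ← ha, sub_self]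
  have h0 := diskValue_sub_smul (integrable_of_memLp (hΘ.memLp_mul hg1m)) hl
  rw [hΘ.analytic_mul hg1m hg1a (-1) (by norm_num)] at h0
  have hmul2 : (fun t => (zeta t - l) • Θ t (g1 t)) = fun t => Θ t (g t) - Θ t a := by
    funext t
    rw [← map_smul, congrFun hmul t, map_sub]
  rw [hmul2, diskValue_sub (integrable_of_memLp (hΘ.memLp_mul hgm))
    (integrable_of_memLp (memLp_apply_const Θ a)) hl, diskValue_apply Θ a hl, sub_eq_zero] at h0
  exact h0

theorem integral_zeta_smul (q : Torus → ℂ) : ∫ t, zeta t • q t ∂mu = fourierCoeff q (-1) := by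
  rw [fourierCoeff, neg_neg]

theorem conj_zeta (t : Torus) : (starRingEnd ℂ) (zeta t) = (zeta t)⁻¹ := by
  refine eq_inv_of_mul_eq_one_left ?_
  rw [mul_comm, RCLike.mul_conj, zeta_norm]
  simp

theorem kernelFun_mem {Θ : L2 (E →L[ℂ] E)} (hΘ : IsInner Θ) {l : ℂ} (hl : ‖l‖ < 1) (x : E) :
    (memLp_kernelFun Θ hl x).toLp (kernelFun Θ l x) ∈ modelSpace Θ := by
  have hc : ‖(starRingEnd ℂ) l‖ < 1 := by rwa [RCLike.norm_conj]
  set y := ContinuousLinearMap.adjoint (diskValue Θ l) x with hy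
  have hm := memLp_kernelFun Θ hl x
  refine ⟨fun n hn => ?_, (Submodule.mem_orthogonal' _ _).mpr fun g' hg' => ?_⟩
  · rw [fourierCoeff_congr_ae hm.coeFn_toLp]
    refine analytic_of_one_sub_smul (integrable_of_memLp hm) hc (fun k hk => ?_) n hn
    have hmul : (fun t => (1 - (starRingEnd ℂ) l * zeta t) • kernelFun Θ l x t)
        = fun t => x - Θ t y := by
      funext t
      exact smul_inv_smul₀ (one_sub_ne_zero hc t) _
    rw [hmul, fourierCoeff_sub' (integrable_const x)
      (integrable_of_memLp (memLp_apply_const Θ y)), fourierCoeff_const, if_neg hk.ne,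
      fourierCoeff_apply, hΘ.mem_hardy k hk, zero_apply, sub_zero]
  · obtain ⟨h, hh, hg'⟩ := hg'
    have hhm := Lp.memLp h
    have hTm := hΘ.memLp_mul hhm
    set p : Torus → ℂ := fun t => ⟪x, Θ t (h t)⟫_ℂ - ⟪y, h t⟫_ℂ with hp
    have hpm : MemLp p 2 mu := (hTm.const_inner x).sub (hhm.const_inner y)
    have hqm : MemLp (fun t => (zeta t - l)⁻¹ • p t) 2 mu :=
      memLp_smul_of_continuous (continuous_sub_inv hl) hpm
    have hmul : (fun t => (zeta t - l) • (zeta t - l)⁻¹ • p t) = p := by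
      funext t
      exact smul_inv_smul₀ (sub_ne_zero' hl t) _
    have hval : diskValue p l = 0 := by
      rw [hp, diskValue_sub (integrable_of_memLp (hTm.const_inner x))
        (integrable_of_memLp (hhm.const_inner y)) hl]
      have e1 := diskValue_clm (innerSL ℂ x) (integrable_of_memLp hTm) hl
      have e2 := diskValue_clm (innerSL ℂ y) (integrable_of_memLp hhm) hl
      simp only [innerSL_apply_apply] at e1 e2
      rw [e1, e2, hΘ.diskValue_mul hhm hh hl, hy, ContinuousLinearMap.adjoint_inner_left, sub_self]
    have h0 := diskValue_sub_smul (integrable_of_memLp hqm) hl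
    rw [hmul, hval] at h0
    rw [L2.inner_def, h0, ← integral_zeta_smul]
    refine integral_congr_ae ?_
    filter_upwards [hm.coeFn_toLp, hg', hΘ.inner_apply] with t h1 h2 h3
    rw [h1, h2, kernelFun, inner_smul_left, inner_sub_left, h3, ← hy, smul_eq_mul, smul_eq_mul,
      ← mul_assoc]
    congr 1
    have hz := zeta_ne_zero t
    have hzl := sub_ne_zero' hl t
    rw [map_inv₀, map_sub, map_mul, map_one, RingHomCompTriple.comp_apply, RingHom.id_apply,
      conj_zeta]
    have e : 1 - l * (zeta t)⁻¹ = (zeta t - l) * (zeta t)⁻¹ := by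
      rw [sub_mul, mul_inv_cancel₀ hz]
    rw [e, mul_inv, inv_inv, mul_comm]

theorem dualKernelFun_mem {Θ : L2 (E →L[ℂ] E)} (hΘ : IsInner Θ) {l : ℂ} (hl : ‖l‖ < 1) (x : E) :
    (memLp_dualKernelFun Θ hl x).toLp (dualKernelFun Θ l x) ∈ modelSpace Θ := by
  have hc : ‖(starRingEnd ℂ) l‖ < 1 := by rwa [RCLike.norm_conj]
  set y := diskValue Θ l x with hy
  have hm := memLp_dualKernelFun Θ hl x
  have hxm := integrable_of_memLp (memLp_apply_const Θ x)
  refine ⟨fun n hn => ?_, (Submodule.mem_orthogonal' _ _).mpr fun g' hg' => ?_⟩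
  · rw [fourierCoeff_congr_ae hm.coeFn_toLp]
    have hmul : (fun t => (zeta t - l) • dualKernelFun Θ l x t) = fun t => Θ t x - y := by
      funext t
      exact smul_inv_smul₀ (sub_ne_zero' hl t) _
    refine analytic_of_sub_smul (integrable_of_memLp hm) hl (fun k hk => ?_) ?_ n hn
    · rw [hmul, fourierCoeff_sub' hxm (integrable_const y), fourierCoeff_const, if_neg hk.ne,
        fourierCoeff_apply, hΘ.mem_hardy k hk, zero_apply, sub_zero]
    · rw [hmul, diskValue_sub hxm (integrable_const y) hl, diskValue_const, diskValue_apply Θ x hl,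
        sub_self]
  · obtain ⟨h, hh, hg'⟩ := hg'
    have hhm := Lp.memLp h
    have hTm := hΘ.memLp_mul hhm
    set p : Torus → ℂ := fun t => ⟪x, h t⟫_ℂ - ⟪y, Θ t (h t)⟫_ℂ with hp
    have hpm : MemLp p 2 mu := (hhm.const_inner x).sub (hTm.const_inner y)
    have hqm : MemLp (fun t => (1 - (starRingEnd ℂ) l * zeta t)⁻¹ • p t) 2 mu :=
      memLp_smul_of_continuous (continuous_one_sub_inv hc) hpm
    have h0 : fourierCoeff (fun t => (1 - (starRingEnd ℂ) l * zeta t)⁻¹ • p t) (-1) = 0 := by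
      refine analytic_of_one_sub_smul (integrable_of_memLp hqm) hc (fun k hk => ?_) (-1)
        (by norm_num)
      have hmul : (fun t => (1 - (starRingEnd ℂ) l * zeta t) •
          (1 - (starRingEnd ℂ) l * zeta t)⁻¹ • p t) = p := by
        funext t
        exact smul_inv_smul₀ (one_sub_ne_zero hc t) _
      rw [hmul, hp, fourierCoeff_sub' (integrable_of_memLp (hhm.const_inner x))
        (integrable_of_memLp (hTm.const_inner y))]
      have e1 := fourierCoeff_clm (innerSL ℂ x) (integrable_of_memLp hhm) k
      have e2 := fourierCoeff_clm (innerSL ℂ y) (integrable_of_memLp hTm) k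
      simp only [innerSL_apply_apply] at e1 e2
      rw [e1, e2, hΘ.analytic_mul hhm hh k hk, hh k hk, inner_zero_right, inner_zero_right,
        sub_zero]
    rw [L2.inner_def, ← h0, ← integral_zeta_smul]
    refine integral_congr_ae ?_
    filter_upwards [hm.coeFn_toLp, hg', hΘ.inner_apply] with t h1 h2 h3
    rw [h1, h2, dualKernelFun, inner_smul_left, inner_sub_left, h3, ← hy, smul_eq_mul, smul_eq_mul,
      ← mul_assoc]
    congr 1
    have hz := zeta_ne_zero t
    rw [map_inv₀, map_sub, conj_zeta]
    have e : (zeta t)⁻¹ - (starRingEnd ℂ) l = (1 - (starRingEnd ℂ) l * zeta t) * (zeta t)⁻¹ := by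
      rw [sub_mul, mul_assoc, mul_inv_cancel₀ hz, one_mul, mul_one]
    rw [e, mul_inv, inv_inv, mul_comm]

/-- The operator `K_l : E → K_Θ` that maps `x` to the function
`(1 - conj l * z)⁻¹ (I - Θ(z) Θ(l)*) x`. -/
def kernelOp {Θ : L2 (E →L[ℂ] E)} (hΘ : IsInner Θ) {l : ℂ} (hl : ‖l‖ < 1) :
    E →L[ℂ] modelSpace Θ :=
  LinearMap.toContinuousLinearMap
    { toFun := fun x => ⟨(memLp_kernelFun Θ hl x).toLp (kernelFun Θ l x), kernelFun_mem hΘ hl x⟩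
      map_add' := fun x y => Subtype.ext <| by
        refine Eq.trans ?_ (MemLp.toLp_add (memLp_kernelFun Θ hl x) (memLp_kernelFun Θ hl y))
        refine MemLp.toLp_congr (memLp_kernelFun Θ hl (x + y)) ((memLp_kernelFun Θ hl x).add (memLp_kernelFun Θ hl y)) (ae_of_all _ fun t => ?_)
        simp only [kernelFun, Pi.add_apply, map_add, ← smul_add]
        congr 1
        abel
      map_smul' := fun c x => Subtype.ext <| by
        refine Eq.trans ?_ (MemLp.toLp_const_smul c (memLp_kernelFun Θ hl x))
        refine MemLp.toLp_congr (memLp_kernelFun Θ hl (c • x)) ((memLp_kernelFun Θ hl x).const_smul c) (ae_of_all _ fun t => ?_)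
        simp only [kernelFun, Pi.smul_apply, map_smul, ← smul_sub]
        rw [smul_comm] }

/-- The operator `K̃_l : E → K_Θ` that maps `x` to the function `(z - l)⁻¹ (Θ(z) - Θ(l)) x`. -/
def dualKernelOp {Θ : L2 (E →L[ℂ] E)} (hΘ : IsInner Θ) {l : ℂ} (hl : ‖l‖ < 1) :
    E →L[ℂ] modelSpace Θ :=
  LinearMap.toContinuousLinearMap
    { toFun := fun x =>
        ⟨(memLp_dualKernelFun Θ hl x).toLp (dualKernelFun Θ l x), dualKernelFun_mem hΘ hl x⟩
      map_add' := fun x y => Subtype.ext <| by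
        refine Eq.trans ?_
          (MemLp.toLp_add (memLp_dualKernelFun Θ hl x) (memLp_dualKernelFun Θ hl y))
        refine MemLp.toLp_congr (memLp_dualKernelFun Θ hl (x + y)) ((memLp_dualKernelFun Θ hl x).add (memLp_dualKernelFun Θ hl y)) (ae_of_all _ fun t => ?_)
        simp only [dualKernelFun, Pi.add_apply, map_add, ← smul_add]
        congr 1
        abel
      map_smul' := fun c x => Subtype.ext <| by
        refine Eq.trans ?_ (MemLp.toLp_const_smul c (memLp_dualKernelFun Θ hl x))
        refine MemLp.toLp_congr (memLp_dualKernelFun Θ hl (c • x)) ((memLp_dualKernelFun Θ hl x).const_smul c) (ae_of_all _ fun t => ?_)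
        simp only [dualKernelFun, Pi.smul_apply, map_smul, ← smul_sub]
        rw [smul_comm] }

end Model

end ModelSpace

end

noncomputable section

namespace ModelSpace

open MeasureTheory AddCircle Complex Filter Topology
open scoped ENNReal InnerProductSpace

set_option linter.unusedSectionVars false

universe u

variable {E : Type*} [NormedAddCommGroup E] [InnerProductSpace ℂ E] [CompleteSpace E]
  [FiniteDimensional ℂ E]

/-! On `K_Θ` the adjoint of `K_l` is evaluation at `l` (`adjoint_kernelOp_apply`), since `K_l x`
differs from the Cauchy kernel `x / (1 - conj l * z)` by an element of `Θ H²(E)`. Hence `K̃_l Y K_l*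
g = (z - l)⁻¹ (Θ - Θ(l)) Y g(l)`. On the other hand, `Θ Y g / (z - l)` is the sum of `Θ Y (g - g(l))
/ (z - l)`, which lies in `Θ H²(E)`, of that same function, and of `Θ(l) Y g(l) / (z - l)`, which is
orthogonal to `H²(E)`. Projecting to `K_Θ` leaves only the middle term, so `Θ Y / (z - l)` is a
symbol (`inner_dualKernelOp_comp`). The operator `K_l Y K̃_l*` is the adjoint of `K̃_l Y* K_l*`, so
the pointwise adjoint of `Θ Y* / (z - l)` is a symbol of it.

For the ranks, purity makes `K_l` and `K̃_l` injective: a vector in either kernel yields some `v`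
with `Θ v` constant; then `Θ v = Θ(0) v` has the norm of `v`, while `‖Θ(0)‖ < 1`, so `v = 0`. An
injective left factor and a surjective right factor, the adjoint of an injective operator, do not
change the rank (`rank_comp_comp_adjoint`). -/

/-! ### Cauchy kernels and difference quotients in `H²(E)` -/

theorem conj_sub_inv (l : ℂ) (t : Torus) :
    (starRingEnd ℂ) (zeta t - l)⁻¹ = zeta t * (1 - (starRingEnd ℂ) l * zeta t)⁻¹ := by
  have hz := zeta_ne_zero t
  have e : (zeta t)⁻¹ - (starRingEnd ℂ) l = (1 - (starRingEnd ℂ) l * zeta t) * (zeta t)⁻¹ := by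
    rw [sub_mul, mul_assoc, mul_inv_cancel₀ hz, one_mul, mul_one]
  rw [map_inv₀, map_sub, conj_zeta, e, mul_inv, inv_inv, mul_comm]

/-- As in `conj_sub_inv`, `conj ζ = ζ⁻¹` on the circle. The factor `zeta t` split off in both
identities turns an inner product with a Cauchy kernel into a Fourier coefficient of index `-1`, via
`integral_zeta_smul`. -/
theorem conj_one_sub_inv (l : ℂ) (t : Torus) :
    (starRingEnd ℂ) (1 - (starRingEnd ℂ) l * zeta t)⁻¹ = zeta t * (zeta t - l)⁻¹ := by
  have hz := zeta_ne_zero t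
  have e : 1 - l * (zeta t)⁻¹ = (zeta t - l) * (zeta t)⁻¹ := by
    rw [sub_mul, mul_inv_cancel₀ hz]
  rw [map_inv₀, map_sub, map_mul, map_one, RingHomCompTriple.comp_apply, RingHom.id_apply,
    conj_zeta, e, mul_inv, inv_inv, mul_comm]

theorem memLp_sub_inv_const {l : ℂ} (hl : ‖l‖ < 1) (c : E) :
    MemLp (fun t => (zeta t - l)⁻¹ • c) 2 mu :=
  memLp_smul_of_continuous (continuous_sub_inv hl) (memLp_const c)

theorem memLp_one_sub_inv_const {l : ℂ} (hl : ‖l‖ < 1) (c : E) :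
    MemLp (fun t => (1 - (starRingEnd ℂ) l * zeta t)⁻¹ • c) 2 mu :=
  memLp_smul_of_continuous (continuous_one_sub_inv (by rwa [RCLike.norm_conj])) (memLp_const c)

/-- The functions `c / (z - l)` are orthogonal to `H²`. -/
theorem inner_sub_inv_const_eq_zero {l : ℂ} (hl : ‖l‖ < 1) (c : E) {f : L2 E}
    (hf : f ∈ Hardy E) : ⟪(memLp_sub_inv_const hl c).toLp _, f⟫_ℂ = 0 := by
  have hc : ‖(starRingEnd ℂ) l‖ < 1 := by rwa [RCLike.norm_conj]
  have hpm : MemLp (fun t => ⟪c, f t⟫_ℂ) 2 mu := (Lp.memLp f).const_inner c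
  have hqm := memLp_smul_of_continuous (continuous_one_sub_inv hc) hpm
  have h0 : fourierCoeff (fun t => (1 - (starRingEnd ℂ) l * zeta t)⁻¹ • ⟪c, f t⟫_ℂ) (-1) = 0 := by
    refine analytic_of_one_sub_smul (integrable_of_memLp hqm) hc (fun k hk => ?_) (-1)
      (by norm_num)
    simp only [smul_inv_smul₀ (one_sub_ne_zero hc _)]
    have e1 := fourierCoeff_clm (innerSL ℂ c) (integrable_L2 f) k
    simp only [innerSL_apply_apply] at e1
    rw [e1, hf k hk, inner_zero_right]
  rw [L2.inner_def, ← h0, ← integral_zeta_smul]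
  refine integral_congr_ae ?_
  filter_upwards [(memLp_sub_inv_const hl c).coeFn_toLp] with t h1
  rw [h1, inner_smul_left, conj_sub_inv, smul_eq_mul, smul_eq_mul, mul_assoc]

/-- The functions `c / (1 - conj l * z)` reproduce the value at `l` of functions in `H²`. -/
theorem inner_one_sub_inv_const {l : ℂ} (hl : ‖l‖ < 1) (c : E) (f : L2 E) :
    ⟪(memLp_one_sub_inv_const hl c).toLp _, f⟫_ℂ = ⟪c, diskValue f l⟫_ℂ := by
  have hpm : MemLp (fun t => ⟪c, f t⟫_ℂ) 2 mu := (Lp.memLp f).const_inner c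
  have hqm := memLp_smul_of_continuous (continuous_sub_inv hl) hpm
  -- The value of `⟪c, f⟫` at `l` is the coefficient of index `-1` of its quotient by `z - l`.
  have h0 := diskValue_sub_smul (integrable_of_memLp hqm) hl
  simp only [smul_inv_smul₀ (sub_ne_zero' hl _)] at h0
  have e1 := diskValue_clm (innerSL ℂ c) (integrable_L2 f) hl
  simp only [innerSL_apply_apply] at e1
  rw [← e1, h0, L2.inner_def, ← integral_zeta_smul]
  refine integral_congr_ae ?_
  filter_upwards [(memLp_one_sub_inv_const hl c).coeFn_toLp] with t h1
  rw [h1, inner_smul_left, conj_one_sub_inv, smul_eq_mul, smul_eq_mul, mul_assoc]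

theorem one_sub_inv_const_mem_Hardy {l : ℂ} (hl : ‖l‖ < 1) (c : E) :
    (memLp_one_sub_inv_const hl c).toLp _ ∈ Hardy E := by
  have hc : ‖(starRingEnd ℂ) l‖ < 1 := by rwa [RCLike.norm_conj]
  intro n hn
  have hm := memLp_one_sub_inv_const hl c
  rw [fourierCoeff_congr_ae hm.coeFn_toLp]
  refine analytic_of_one_sub_smul (integrable_of_memLp hm) hc (fun k hk => ?_) n hn
  simp only [smul_inv_smul₀ (one_sub_ne_zero hc _)]
  rw [fourierCoeff_const, if_neg hk.ne]

/-- The difference quotient `(f - f(l)) / (z - l)` of a function in `H²` is in `H²`. -/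
theorem fourierCoeff_diffQuotient {l : ℂ} (hl : ‖l‖ < 1) {f : L2 E} (hf : f ∈ Hardy E) :
    ∀ n : ℤ, n < 0 → fourierCoeff (fun t => (zeta t - l)⁻¹ • (f t - diskValue f l)) n = 0 := by
  have hm : MemLp (fun t => (zeta t - l)⁻¹ • (f t - diskValue f l)) 2 mu :=
    memLp_smul_of_continuous (continuous_sub_inv hl) ((Lp.memLp f).sub (memLp_const _))
  refine analytic_of_sub_smul (integrable_of_memLp hm) hl (fun n hn => ?_) ?_
  · simp only [smul_inv_smul₀ (sub_ne_zero' hl _)]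
    rw [fourierCoeff_sub' (integrable_L2 f) (integrable_const _), hf n hn,
      fourierCoeff_const, if_neg hn.ne, sub_zero]
  · simp only [smul_inv_smul₀ (sub_ne_zero' hl _)]
    rw [diskValue_sub (integrable_L2 f) (integrable_const _) hl, diskValue_const, sub_self]

/-! ### The adjoint of `K_l` -/

section Operators

variable {Θ : L2 (E →L[ℂ] E)} (hΘ : IsInner Θ) {l : ℂ} (hl : ‖l‖ < 1)

theorem coe_kernelOp (x : E) :
    ((kernelOp hΘ hl x : modelSpace Θ) : L2 E) = (memLp_kernelFun Θ hl x).toLp _ := rfl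

theorem coe_dualKernelOp (x : E) :
    ((dualKernelOp hΘ hl x : modelSpace Θ) : L2 E) = (memLp_dualKernelFun Θ hl x).toLp _ := rfl

theorem toLp_mul_mem_mulHardy {g : Torus → E} (hg : MemLp g 2 mu)
    (hga : ∀ n : ℤ, n < 0 → fourierCoeff g n = 0) :
    (hΘ.memLp_mul hg).toLp _ ∈ mulHardy Θ := by
  refine ⟨hg.toLp g, fun n hn => ?_, ?_⟩
  · rw [fourierCoeff_congr_ae hg.coeFn_toLp, hga n hn]
  · filter_upwards [hg.coeFn_toLp, (hΘ.memLp_mul hg).coeFn_toLp] with t h1 h2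
    rw [h1, h2]

theorem inner_eq_zero_of_mem_mulHardy {u : L2 E} (hu : u ∈ mulHardy Θ) (f : modelSpace Θ) :
    ⟪u, (f : L2 E)⟫_ℂ = 0 :=
  (Submodule.mem_orthogonal _ _).mp f.2.2 u hu

/-- The adjoint of `K_l` is the evaluation at `l`. -/
theorem adjoint_kernelOp_apply (f : modelSpace Θ) :
    (kernelOp hΘ hl).adjoint f = diskValue (f : L2 E) l := by
  refine ext_inner_left ℂ fun x => ?_
  -- The sign is reversed so that the remaining vector, the Cauchy kernel minus `K_l x`, is `Θ`
  -- times `Θ(l)* x / (1 - conj l * z)`, with no minus sign.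
  rw [ContinuousLinearMap.adjoint_inner_right, ← inner_one_sub_inv_const hl x (f : L2 E),
    Submodule.coe_inner, ← sub_eq_zero, ← inner_sub_left, ← neg_eq_zero, ← inner_neg_left]
  refine inner_eq_zero_of_mem_mulHardy ?_ f
  have hm := memLp_one_sub_inv_const hl (ContinuousLinearMap.adjoint (diskValue Θ l) x)
  refine ⟨hm.toLp _, one_sub_inv_const_mem_Hardy hl _, ?_⟩
  rw [coe_kernelOp, neg_sub]
  filter_upwards [hm.coeFn_toLp, (memLp_one_sub_inv_const hl x).coeFn_toLp,
    (memLp_kernelFun Θ hl x).coeFn_toLp, Lp.coeFn_sub ((memLp_one_sub_inv_const hl x).toLp _)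
      ((memLp_kernelFun Θ hl x).toLp _)] with t h1 h2 h3 h4
  rw [h4, Pi.sub_apply, h1, h2, h3, kernelFun, map_smul, smul_sub, sub_sub_cancel]

/-! ### Symbols of the two operators -/

/-- Since `Θ` is isometric almost everywhere, `g` need not be bounded. This matters in
`kernelOp_comp_mem_MT`, where the symbol of the adjoint operator acts on the arbitrary test vector
and not on the bounded one. -/
theorem memLp_toeplitzSymbol_apply (hΘ : IsInner Θ) (hl : ‖l‖ < 1) (Y : E →L[ℂ] E) (g : L2 E) :
    MemLp (fun t => (zeta t - l)⁻¹ • Θ t (Y (g t))) 2 mu :=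
  memLp_smul_of_continuous (continuous_sub_inv hl)
    (hΘ.memLp_mul (Y.comp_memLp' (Lp.memLp g)))

/-- The operator `K̃_l Y K_l*` is the compression of the multiplication by `Θ Y / (z - l)`. -/
theorem inner_dualKernelOp_comp (Y : E →L[ℂ] E) (g f : modelSpace Θ) :
    ⟪(dualKernelOp hΘ hl ∘L Y ∘L (kernelOp hΘ hl).adjoint) g, f⟫_ℂ
      = ⟪(memLp_toeplitzSymbol_apply hΘ hl Y (g : L2 E)).toLp _, (f : L2 E)⟫_ℂ := by
  set a := diskValue (g : L2 E) l with ha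
  have hqm : MemLp (fun t => (zeta t - l)⁻¹ • ((g : L2 E) t - a)) 2 mu :=
    memLp_smul_of_continuous (continuous_sub_inv hl) ((Lp.memLp (g : L2 E)).sub (memLp_const _))
  have hYq : MemLp (fun t => Y ((zeta t - l)⁻¹ • ((g : L2 E) t - a))) 2 mu := Y.comp_memLp' hqm
  -- The constant operator `Y` preserves analyticity of the difference quotient, so `Θ` times the
  -- result is in `Θ H²(E)`.
  have h1 := inner_eq_zero_of_mem_mulHardy (toLp_mul_mem_mulHardy hΘ hYq fun n hn => by
    rw [fourierCoeff_clm Y (integrable_of_memLp hqm), fourierCoeff_diffQuotient hl g.2.1 n hn,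
      map_zero]) f
  have h2 := inner_sub_inv_const_eq_zero hl (diskValue Θ l (Y a)) f.2.1
  -- Add and subtract `Θ Y a` and `Θ(l) Y a` in the numerator; `h1` and `h2` remove the outer two
  -- terms.
  have h3 : (memLp_toeplitzSymbol_apply hΘ hl Y (g : L2 E)).toLp _
      = (hΘ.memLp_mul hYq).toLp _ + ((memLp_dualKernelFun Θ hl (Y a)).toLp _
        + (memLp_sub_inv_const hl (diskValue Θ l (Y a))).toLp _) := by
    rw [← MemLp.toLp_add, ← MemLp.toLp_add]
    refine MemLp.toLp_congr _ _ (ae_of_all _ fun t => ?_)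
    simp only [Pi.add_apply, dualKernelFun, map_smul, map_sub, smul_sub]
    abel
  rw [h3, inner_add_left, inner_add_left, h1, h2, add_zero, zero_add, ← coe_dualKernelOp hΘ hl,
    ContinuousLinearMap.comp_apply, ContinuousLinearMap.comp_apply, adjoint_kernelOp_apply,
    Submodule.coe_inner]

theorem memLp_toeplitzSymbol (Θ : L2 (E →L[ℂ] E)) (hl : ‖l‖ < 1) (Y : E →L[ℂ] E) :
    MemLp (fun t => (zeta t - l)⁻¹ • (Θ t ∘L Y)) 2 mu :=
  memLp_smul_of_continuous (continuous_sub_inv hl)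
    (((ContinuousLinearMap.compL ℂ E E E).flip Y).comp_memLp' (Lp.memLp Θ))

theorem memLp_adjoint {Φ : Torus → E →L[ℂ] E} (hΦ : MemLp Φ 2 mu) :
    MemLp (fun t => ContinuousLinearMap.adjoint (Φ t)) 2 mu :=
  hΦ.of_le (ContinuousLinearMap.adjoint.continuous.comp_aestronglyMeasurable hΦ.1)
    (ae_of_all _ fun t => by rw [LinearIsometryEquiv.norm_map])

/-- Membership can be tested weakly: against vectors of `K_Θ` the projection `P_Θ` disappears. -/
theorem mem_MT_of_inner {A : modelSpace Θ →L[ℂ] modelSpace Θ} (Φ : L2 (E →L[ℂ] E))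
    (h : ∀ (f g : modelSpace Θ) (hf : MemLp ((f : L2 E) : Torus → E) ∞ mu),
      ⟪A f, g⟫_ℂ = ⟪mulBounded Φ f hf, (g : L2 E)⟫_ℂ) : A ∈ MT Θ :=
  ⟨Φ, fun f hf => ext_inner_right ℂ fun g => by
    rw [h f g hf, Submodule.inner_orthogonalProjectionOnto_eq_of_mem_right]⟩

theorem dualKernelOp_comp_mem_MT (Y : E →L[ℂ] E) :
    dualKernelOp hΘ hl ∘L Y ∘L (kernelOp hΘ hl).adjoint ∈ MT Θ := by
  refine mem_MT_of_inner ((memLp_toeplitzSymbol Θ hl Y).toLp _) fun f g hf => ?_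
  rw [inner_dualKernelOp_comp]
  congr 1
  refine MemLp.toLp_congr _ _ ?_
  filter_upwards [(memLp_toeplitzSymbol Θ hl Y).coeFn_toLp] with t h1
  rw [h1]
  rfl

/-- Passing to the adjoint replaces `Y` by `Z = Y*`, exchanges the two kernel operators and takes
the pointwise adjoint of the symbol. -/
theorem kernelOp_comp_mem_MT (Y : E →L[ℂ] E) :
    kernelOp hΘ hl ∘L Y ∘L (dualKernelOp hΘ hl).adjoint ∈ MT Θ := by
  set Z := ContinuousLinearMap.adjoint Y with hZ
  have hadj := memLp_adjoint (memLp_toeplitzSymbol Θ hl Z)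
  refine mem_MT_of_inner (hadj.toLp _) fun f g hf => ?_
  have h1 : ⟪(kernelOp hΘ hl ∘L Y ∘L (dualKernelOp hΘ hl).adjoint) f, g⟫_ℂ
      = ⟪f, (dualKernelOp hΘ hl ∘L Z ∘L (kernelOp hΘ hl).adjoint) g⟫_ℂ := by
    simp only [ContinuousLinearMap.comp_apply]
    rw [← ContinuousLinearMap.adjoint_inner_left, hZ, ContinuousLinearMap.adjoint_inner_right,
      ContinuousLinearMap.adjoint_inner_right]
  -- The weak formula has the operator in the first slot, hence the conjugation before and after its
  -- use.
  rw [h1, ← inner_conj_symm f, inner_dualKernelOp_comp, inner_conj_symm, L2.inner_def, L2.inner_def]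
  refine integral_congr_ae ?_
  filter_upwards [hadj.coeFn_toLp, (memLp_apply (hadj.toLp _) hf).coeFn_toLp,
    (memLp_toeplitzSymbol_apply hΘ hl Z (g : L2 E)).coeFn_toLp] with t h2 h3 h4
  rw [mulBounded, h3, h4, h2, ContinuousLinearMap.adjoint_inner_left]
  rfl

/-! ### Injectivity and rank -/

/-- A pure inner function maps only the zero vector to a constant function. -/
theorem IsInner.eq_zero_of_apply_const (hΘ : IsInner Θ) (hpure : IsPure Θ) {x y : E}
    (h : ∀ᵐ t ∂mu, Θ t x = y) : x = 0 := by
  have hnorm : ‖x‖ = ‖y‖ := by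
    -- One point of the circle where both properties hold is enough to compare the constant norms.
    obtain ⟨t, h1, h2⟩ := (h.and hΘ.inner_apply).exists
    rw [← h1, @norm_eq_sqrt_re_inner ℂ, @norm_eq_sqrt_re_inner ℂ _ _ _ _ (Θ t x), h2]
  have hval : diskValue Θ 0 x = y := by
    rw [← diskValue_apply Θ x (by simp), ← diskValue_const y 0]
    unfold diskValue
    simp only [fourierCoeff_congr_ae h]
  by_contra hx
  have h1 := (diskValue Θ 0).le_opNorm x
  rw [hval, ← hnorm] at h1
  have h2 := mul_lt_mul_of_pos_right hpure (norm_pos_iff.mpr hx)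
  linarith

theorem kernelOp_injective (hpure : IsPure Θ) : Function.Injective (kernelOp hΘ hl) := by
  have hc : ‖(starRingEnd ℂ) l‖ < 1 := by rwa [RCLike.norm_conj]
  refine (injective_iff_map_eq_zero _).mpr fun x hx => ?_
  have h0 : (memLp_kernelFun Θ hl x).toLp _ = 0 := congrArg Subtype.val hx
  have h : ∀ᵐ t ∂mu, Θ t (ContinuousLinearMap.adjoint (diskValue Θ l) x) = x := by
    filter_upwards [(memLp_kernelFun Θ hl x).coeFn_toLp, Lp.coeFn_zero E 2 mu] with t h1 h2
    rw [h0, h2, Pi.zero_apply, kernelFun, eq_comm, smul_eq_zero_iff_right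
      (inv_ne_zero (one_sub_ne_zero hc t)), sub_eq_zero] at h1
    exact h1.symm
  have hy := hΘ.eq_zero_of_apply_const hpure h
  -- Purity has only killed `Θ(l)* x`; the vector `x` is its image under `Θ t`, so it vanishes too.
  obtain ⟨t, ht⟩ := h.exists
  rw [← ht, hy, map_zero]

theorem dualKernelOp_injective (hpure : IsPure Θ) : Function.Injective (dualKernelOp hΘ hl) := by
  refine (injective_iff_map_eq_zero _).mpr fun x hx => ?_
  have h0 : (memLp_dualKernelFun Θ hl x).toLp _ = 0 := congrArg Subtype.val hx
  refine hΘ.eq_zero_of_apply_const hpure (y := diskValue Θ l x) ?_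
  filter_upwards [(memLp_dualKernelFun Θ hl x).coeFn_toLp, Lp.coeFn_zero E 2 mu] with t h1 h2
  rw [h0, h2, Pi.zero_apply, dualKernelFun, eq_comm, smul_eq_zero_iff_right
    (inv_ne_zero (sub_ne_zero' hl t)), sub_eq_zero] at h1
  exact h1

end Operators

/-- The adjoint of an injective operator on a finite-dimensional space is surjective. -/
theorem adjoint_surjective_of_injective {H : Type*} [NormedAddCommGroup H] [InnerProductSpace ℂ H]
    [CompleteSpace H] {S : E →L[ℂ] H} (hS : Function.Injective S) :
    Function.Surjective S.adjoint := by
  -- In finite dimension a subspace with trivial orthogonal complement is everything.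
  rw [← ContinuousLinearMap.coe_coe, ← LinearMap.range_eq_top,
    ← Submodule.orthogonal_eq_bot_iff, Submodule.eq_bot_iff]
  intro x hx
  refine hS ?_
  -- If `x` is orthogonal to the range of `S*`, then `‖S x‖² = ⟪S* S x, x⟫ = 0`.
  rw [map_zero, ← inner_self_eq_zero (𝕜 := ℂ), ← ContinuousLinearMap.adjoint_inner_left]
  exact (Submodule.mem_orthogonal _ _).mp hx _ ⟨S x, rfl⟩

/-- Surjectivity of `S*` makes the range of the composite the image under `R` of the range of `Y`,
and `R` embeds it. The common universe lets the two cardinals be equated without lifts; `K_Θ` lives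
in the universe of `E`. -/
theorem rank_comp_comp_adjoint {E H : Type u} [NormedAddCommGroup E] [InnerProductSpace ℂ E]
    [CompleteSpace E] [FiniteDimensional ℂ E] [NormedAddCommGroup H] [InnerProductSpace ℂ H]
    [CompleteSpace H] {R S : E →L[ℂ] H} (hR : Function.Injective R) (hS : Function.Injective S)
    (Y : E →L[ℂ] E) :
    LinearMap.rank (R ∘L Y ∘L S.adjoint).toLinearMap = LinearMap.rank Y.toLinearMap := by
  have h : LinearMap.range (R ∘L Y ∘L S.adjoint).toLinearMap
      = (LinearMap.range Y.toLinearMap).map R.toLinearMap := by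
    rw [ContinuousLinearMap.toLinearMap_comp, ContinuousLinearMap.toLinearMap_comp,
      LinearMap.range_comp, LinearMap.range_comp_of_range_eq_top]
    exact LinearMap.range_eq_top.mpr (adjoint_surjective_of_injective hS)
  rw [LinearMap.rank, h]
  exact (Submodule.equivMapOfInjective R.toLinearMap hR _).rank_eq.symm

end ModelSpace

end

theorem mainTheorem7 {E : Type*} [NormedAddCommGroup E] [InnerProductSpace ℂ E] [CompleteSpace E]
    [FiniteDimensional ℂ E] (Θ : ModelSpace.L2 (E →L[ℂ] E)) (hΘ : ModelSpace.IsInner Θ)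
    (hpure : ModelSpace.IsPure Θ) (Y : E →L[ℂ] E) (l : ℂ) (hl : ‖l‖ < 1) :
    (ModelSpace.kernelOp hΘ hl ∘L Y ∘L (ModelSpace.dualKernelOp hΘ hl).adjoint
        ∈ ModelSpace.MT Θ ∧
      LinearMap.rank (ModelSpace.kernelOp hΘ hl ∘L Y ∘L
          (ModelSpace.dualKernelOp hΘ hl).adjoint).toLinearMap
        = LinearMap.rank Y.toLinearMap) ∧
    (ModelSpace.dualKernelOp hΘ hl ∘L Y ∘L (ModelSpace.kernelOp hΘ hl).adjoint
        ∈ ModelSpace.MT Θ ∧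
      LinearMap.rank (ModelSpace.dualKernelOp hΘ hl ∘L Y ∘L
          (ModelSpace.kernelOp hΘ hl).adjoint).toLinearMap
        = LinearMap.rank Y.toLinearMap) := by
  have hk := ModelSpace.kernelOp_injective hΘ hl hpure
  have hd := ModelSpace.dualKernelOp_injective hΘ hl hpure
  exact ⟨⟨ModelSpace.kernelOp_comp_mem_MT hΘ hl Y, ModelSpace.rank_comp_comp_adjoint hk hd Y⟩,
    ModelSpace.dualKernelOp_comp_mem_MT hΘ hl Y, ModelSpace.rank_comp_comp_adjoint hd hk Y⟩
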